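/- Let $\kappa$ be an (infinite) regular cardinal and let $\mathcal{C}$ be a small category having all $\kappa$-small connected limits (limits of connected diagrams with fewer than $\kappa$ arrows), with a Grothendieck topology $J$. A *$\kappa$-cotree* is a poset with a maximum (the root) in which every nonempty interval $[x,y]$ is isomorphic to the dual of an ordinal $<\kappa$ and every branch (maximal chain) has fewer than $\kappa$ elements. A *$\kappa$-cotree in $\mathcal{C}$ with predecessors in* $\mathcal{B}$, where $\mathcal{B}(C)$ is a set of presieves on $C$ for each object $C$, is a functor $F$ from a $\kappa$-cotree to $\mathcal{C}$ together with a set of minimal nodes, called leaves, such that: (i) if $x$ is a node at limit height (a non-root node that is not an immediate predecessor of any node), then $F(x)$, with the maps $F(x)\to F(y)$, is the limit of the $F(y)$ for $y>x$; (ii) for each node $x$ which is not a leaf, the arrows $F(y)\to F(x)$, for $y$ an immediate predecessor of $x$ in the poset (i.e. $y<x$ with nothing strictly in between), form a presieve in $\mathcal{B}(F(x))$. (So a minimal node that is not a leaf is covered by the empty presieve, which must then belong to $\mathcal{B}$.) Its *multicomposite* is the sieve on $F(\text{root})$ generated by the maps $\lim_{x\in b}F(x)\to F(\text{root})$, where $b$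 runs over the branches that do not end at a non-leaf minimal node. A *$\kappa$-warp* for $J$ is a family $\mathcal{B}(C)$ of sets of $J$-covering presieves on $C$, for each object $C$, such that 1. for every $f:D\to C$ and $R\in\mathcal{B}(C)$, the pullback along $f$ of the sieve generated by $R$ contains a presieve in $\mathcal{B}(D)$; 2. every $J$-covering sieve on an object $C$ contains the multicomposite of some $\kappa$-cotree in $\mathcal{C}$ with root $C$ and predecessors in $\mathcal{B}$, and conversely the multicomposite of every $\kappa$-cotree in $\mathcal{C}$ with predecessors in $\mathcal{B}$ is $J$-covering. Suppose that $(\mathcal{C},J)$ is *$\kappa$-woven*: $J$ has a $\kappa$-warp $\mathcal{B}$ such that $\mathcal{B}(C)$ has at most $\kappa$ elements for every object $C$. **Theorem.** Then (in classical logic with the axiom of choice) $\mathrm{Sh}(\mathcal{C},J)$ has enough $\kappa$-points: there is a set of points of $\mathrm{Sh}(\mathcal{C},J)$ whose inverse image functors $\mathrm{Sh}(\mathcal{C},J)\to\mathrm{Set}$ preserve all limits of diagrams with fewer than $\kappa$ arrows and are jointly conservative. -/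

import Mathlib

universe u

open CategoryTheory CategoryTheory.Limits

/-- Every limit of a connected diagram with fewer than `κ` arrows exists in `C`. -/
def HasConnectedLimitsLT (C : Type u) [SmallCategory C] (κ : Cardinal.{u}) : Prop :=
  ∀ (K : Type u) [SmallCategory K] [IsConnected K],
    HasCardinalLT (Arrow K) κ → HasLimitsOfShape K C

/-- A `κ`-cotree: a poset with a maximum in which every nonempty interval is isomorphic to the
dual of an ordinal `< κ`, and in which moreover every branch (maximal chain) is shorter than `κ`,
so that the limit of a diagram along a branch is the limit of a `<κ`-cochain.
For `κ = ℵ₀` the branches are finite. -/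
structure IsKappaCotree (κ : Cardinal.{u}) (P : Type u) [PartialOrder P] [OrderTop P] : Prop where
  interval : ∀ x y : P, x ≤ y →
    ∃ o : Ordinal.{u}, o < κ.ord ∧ Nonempty (Set.Icc x y ≃o (Set.Iio o)ᵒᵈ)
  branch : ∀ c : Set P, IsMaxChain (· ≤ ·) c → Cardinal.mk c < κ

section Diagrams

variable {C : Type u} [SmallCategory C] {P : Type u} [PartialOrder P]

/-- The restriction of a diagram on a poset to a subset. -/
def restrictDiagram (F : P ⥤ C) (s : Set P) : s ⥤ C :=
  (Subtype.mono_coe (· ∈ s)).functor ⋙ F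

/-- The cone with apex `F x` over the part of the diagram lying strictly above `x`. -/
def coneAbove (F : P ⥤ C) (x : P) : Cone (restrictDiagram F (Set.Ioi x)) where
  pt := F.obj x
  π :=
    { app := fun y => F.map (homOfLE (le_of_lt y.2))
      naturality := fun y z f => by
        simp only [restrictDiagram, Functor.const_obj_obj, Functor.const_obj_map,
          Category.id_comp, Functor.comp_map]
        exact (congrArg F.map (Subsingleton.elim _ _)).trans (F.map_comp _ _) }

/-- The presieve on `F x` consisting of the edges of the diagram from the immediate predecessors
of `x` into `x`. -/
def predecessors (F : P ⥤ C) (x : P) : Presieve (F.obj x) :=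
  Presieve.ofArrows (fun y : {y : P // y ⋖ x} => F.obj y.1)
    (fun y => F.map (homOfLE y.2.le))

end Diagrams

/-- A (continuous) `κ`-cotree in `C` in which the predecessors of each node form a presieve
in `B`, except at a set of minimal nodes (the leaves) where the cotree stops.
A minimal node which is not a leaf is one that is covered by the empty presieve
(which then has to belong to `B`). -/
structure KappaCotreeIn {C : Type u} [SmallCategory C] (κ : Cardinal.{u})
    (B : ∀ X : C, Set (Presieve X)) where
  /-- the underlying poset -/
  P : Type u
  [partialOrder : PartialOrder P]
  [orderTop : OrderTop P]
  isKappaCotree : IsKappaCotree κ P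
  /-- the diagram -/
  F : P ⥤ C
  /-- at a node at limit height, the diagram is the limit of its values below that height -/
  continuous : ∀ x : P, Order.IsPredLimit x → Nonempty (IsLimit (coneAbove F x))
  /-- the nodes where the cotree stops -/
  leaf : Set P
  isMin_of_leaf : ∀ x ∈ leaf, IsMin x
  predecessors_mem : ∀ x, x ∉ leaf → predecessors F x ∈ B (F.obj x)

attribute [instance] KappaCotreeIn.partialOrder KappaCotreeIn.orderTop

namespace KappaCotreeIn

variable {C : Type u} [SmallCategory C] {κ : Cardinal.{u}} {B : ∀ X : C, Set (Presieve X)}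

/-- The arrows to the root of a cotree from the limits of its maximal branches
(a branch ending at a node that is covered by the empty presieve contributes nothing). -/
inductive BranchLimits (T : KappaCotreeIn κ B) : Presieve (T.F.obj ⊤)
  | mk (c : Set T.P) (hc : IsMaxChain (· ≤ ·) c) (hleaf : ∀ x ∈ c, IsMin x → x ∈ T.leaf)
      (s : Cone (restrictDiagram T.F c)) (hs : IsLimit s) :
      BranchLimits T (s.π.app ⟨⊤, hc.top_mem⟩)

/-- The multicomposite of a cotree: the sieve on its root generated by the limits of its
maximal branches. -/
def multicomposite (T : KappaCotreeIn κ B) : Sieve (T.F.obj ⊤) :=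
  Sieve.generate (BranchLimits T)

end KappaCotreeIn

/-- `S` is the multicomposite of a `κ`-cotree built from presieves in `B`. -/
inductive IsMulticomposite {C : Type u} [SmallCategory C] (κ : Cardinal.{u})
    (B : ∀ X : C, Set (Presieve X)) : ∀ {X : C}, Sieve X → Prop
  | mk (T : KappaCotreeIn κ B) : IsMulticomposite κ B T.multicomposite

/-- `B` is a `κ`-warp for the Grothendieck topology `J`. -/
structure IsKappaWarp {C : Type u} [SmallCategory C] (J : GrothendieckTopology C)
    (κ : Cardinal.{u}) (B : ∀ X : C, Set (Presieve X)) : Prop where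
  covering : ∀ (X : C), ∀ R ∈ B X, Sieve.generate R ∈ J X
  pullback : ∀ {X Y : C} (f : Y ⟶ X), ∀ R ∈ B X,
    ∃ R' ∈ B Y, R' ≤ ((Sieve.generate R).pullback f).arrows
  contains_multicomposite : ∀ (X : C), ∀ S ∈ J X, ∃ M : Sieve X, IsMulticomposite κ B M ∧ M ≤ S
  multicomposite_covering : ∀ {X : C} (M : Sieve X), IsMulticomposite κ B M → M ∈ J X

/-- The site `(C, J)` is `κ`-woven: `J` has a `κ`-warp with at most `κ` presieves on each
object. -/
def IsKappaWoven {C : Type u} [SmallCategory C] (J : GrothendieckTopology C)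
    (κ : Cardinal.{u}) : Prop :=
  ∃ B : ∀ X : C, Set (Presieve X), IsKappaWarp J κ B ∧ ∀ X : C, Cardinal.mk (B X) ≤ κ

/-- A `κ`-point of `Sh(C, J)`: a point whose inverse image functor `Sh(C, J) ⥤ Type u`
preserves limits of size `< κ`. -/
def IsKappaPoint {C : Type u} [SmallCategory C] {J : GrothendieckTopology C}
    (κ : Cardinal.{u}) (p : GrothendieckTopology.Point.{u} J) : Prop :=
  ∀ (K : Type u) [SmallCategory K], HasCardinalLT (Arrow K) κ →
    PreservesLimitsOfShape K (p.sheafFiber (A := Type u))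

/-- `Sh(C, J)` has enough `κ`-points: there is a (small) set of `κ`-points whose inverse image
functors jointly reflect isomorphisms. -/
def HasEnoughKappaPoints {C : Type u} [SmallCategory C] (J : GrothendieckTopology C)
    (κ : Cardinal.{u}) : Prop :=
  ∃ Q : ObjectProperty (GrothendieckTopology.Point.{u} J),
    ObjectProperty.Small.{u} Q ∧ Q.IsConservativeFamilyOfPoints ∧ ∀ p, Q p → IsKappaPoint κ p

/-!
# Enough `κ`-points for `κ`-woven sites

By the criterion of SGA 4 IV 6.5, it is enough to find, for each sieve `S` on `X` that is not
covering, a `κ`-point whose fiber at `X` has an element that does not come from any arrow in `S`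
(`exists_isKappaPoint_of_notMem`).

The point is pro-represented by a cochain `D` of length `κ` over `X` such that every presieve in
the warp `B` on some `D α`, and therefore also the pullback to `D α` of any presieve in `B`, is
eventually lifted through, while no composite `D γ ⟶ X` is in `S` (`IsKappaWarp.exists_cochain`).
To find it, consider all the ways of building such a cochain: at a successor step of length `β`,
choose a member of a presieve in `B` that refines the pullback of the presieve scheduled for the
time `β`, where a schedule exists because there are at most `κ` presieves on each of the `κ` many
stages; at a limit step, take the limit; and stop as soon as the composite to `X` is in `S`. This
gives a tree of partial cochains (`admissible`). If none of them went on for `κ` steps, the tree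
would be a `κ`-cotree with multicomposite contained in `S` (`exists_isMulticomposite_le`), so that
`S` would be covering.

The fiber functor `E` of `D` is a `κ`-filtered colimit of representable functors, so it preserves
limits of size `< κ` (`preservesLimitsOfShape_colim_of_isCardinalFiltered`), and it sends presieves
in `B` to jointly surjective families. By continuity of cotrees, it does the same with
multicomposites, hence with all the covering sieves
(`KappaCotreeIn.exists_lift_multicomposite`): `E` is a point. The same interchange of limits and
colimits, for the fibers of sheaves, shows that it is a `κ`-point.

The tree lives inside the tree `SeqTree` of all the sequences of arrows of `C`, composable or not.
The diagram on it is built by well-founded recursion (`exists_functor_coneAbove_eq`), before the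
presieves to choose from, which depend on the values of the diagram, are known.
-/

/-! ### Limits of size `< κ` commute with `κ`-filtered colimits of types -/

section Interchange

variable {κ : Cardinal.{u}} [Fact κ.IsRegular] (J : Type u) [SmallCategory J]
  [IsCardinalFiltered J κ] (K : Type u) [SmallCategory K]

/-- In `Type u`, colimits over a `κ`-filtered category commute with limits of diagrams with fewer
than `κ` arrows. -/
theorem preservesLimitsOfShape_colim_of_isCardinalFiltered (hK : HasCardinalLT (Arrow K) κ) :
    PreservesLimitsOfShape K (colim : (J ⥤ Type u) ⥤ Type u) := by
  have := isFiltered_of_isCardinalFiltered J κ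
  have hK' : HasCardinalLT K κ := hasCardinalLT_of_hasCardinalLT_arrow hK
  let ι (G : J ⥤ Type u) (j : J) (x : G.obj j) : colim.obj G := colimit.ι G j x
  have surj (G : J ⥤ Type u) (y : colim.obj G) : ∃ j x, ι G j x = y :=
    Types.jointly_surjective_of_isColimit (colimit.isColimit G) y
  have eq_iff (G : J ⥤ Type u) (j : J) (x y : G.obj j) :
      ι G j x = ι G j y ↔ ∃ (j' : J) (a : j ⟶ j'), G.map a x = G.map a y :=
    Types.FilteredColimit.isColimit_eq_iff' (colimit.isColimit G) x y
  have w (G : J ⥤ Type u) {j j' : J} (a : j ⟶ j') (x : G.obj j) :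
      ι G j' (G.map a x) = ι G j x := ConcreteCategory.congr_hom (colimit.w G a) x
  have nat {G G' : J ⥤ Type u} (f : G ⟶ G') (j : J) (x : G.obj j) :
      colim.map f (ι G j x) = ι G' j (f.app j x) :=
    ConcreteCategory.congr_hom (ι_colimMap f j) x
  clear_value ι
  refine ⟨fun {F} => ⟨fun {c} hc => (Types.isLimit_iff _).2 fun s hs => ?_⟩⟩
  have hc' (j : J) := isLimitOfPreserves ((evaluation J (Type u)).obj j) hc
  -- The components of the section live at a common stage of the colimit, ...
  obtain ⟨j₀, z, hz⟩ : ∃ (j₀ : J) (z : (k : K) → (F.obj k).obj j₀),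
      ∀ k, ι (F.obj k) j₀ (z k) = s k := by
    choose j z hz using fun k => surj (F.obj k) (s k)
    exact ⟨IsCardinalFiltered.max j hK',
      fun k => (F.obj k).map (IsCardinalFiltered.toMax j hK' k) (z k),
      fun k => by rw [w, hz]⟩
  -- ... and at a later stage they form a section.
  obtain ⟨j₁, a, ha⟩ : ∃ (j₁ : J) (a : j₀ ⟶ j₁), ∀ f : Arrow K,
      (F.obj f.right).map a ((F.map f.hom).app _ (z f.left)) =
        (F.obj f.right).map a (z f.right) := by
    have H (f : Arrow K) := (eq_iff (F.obj f.right) j₀ ((F.map f.hom).app _ (z f.left))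
      (z f.right)).1 (by rw [← nat, hz, hz]; exact hs f.hom)
    choose j a h using H
    obtain ⟨m, b, d, hbd⟩ := IsCardinalFiltered.wideSpan a hK
    refine ⟨m, d, fun f => ?_⟩
    rw [← hbd f]
    simp only [Functor.map_comp, ConcreteCategory.comp_apply, h]
  have hsec : (fun k => (F.obj k).map a (z k)) ∈
      (F ⋙ (evaluation J (Type u)).obj j₁).sections := by
    intro k k' f
    have := ha (Arrow.mk f)
    dsimp at this ⊢
    rw [← this, NatTrans.naturality_apply]
  obtain ⟨x, hx, -⟩ := (Types.isLimit_iff _).1 ⟨hc' j₁⟩ _ hsec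
  let q (k : K) : c.pt ⟶ F.obj k := c.π.app k
  replace hx (k : K) : (q k).app j₁ x = (F.obj k).map a (z k) := hx k
  suffices ∃! x, ∀ k, colim.map (q k) x = s k from this
  refine ⟨ι c.pt j₁ x, fun k => by rw [nat, hx, w, hz], fun y hy => ?_⟩
  obtain ⟨j₂, y, rfl⟩ := surj _ y
  -- Both elements have the same components, so these agree at some stage, the same for all `k`.
  let j₃ := IsFiltered.max j₁ j₂
  let x' := c.pt.map (IsFiltered.leftToMax j₁ j₂) x
  let y' := c.pt.map (IsFiltered.rightToMax j₁ j₂) y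
  have hx' : ι c.pt j₃ x' = ι c.pt j₁ x := w _ _ _
  have hy' : ι c.pt j₃ y' = ι c.pt j₂ y := w _ _ _
  clear_value x' y'
  have key (k : K) : ι (F.obj k) j₃ ((q k).app j₃ x') = ι (F.obj k) j₃ ((q k).app j₃ y') := by
    rw [← nat, ← nat, hx', hy', hy, nat, hx, w, hz]
  choose j b h using fun k => (eq_iff _ _ _ _).1 (key k)
  obtain ⟨m, d, e, hde⟩ := IsCardinalFiltered.wideSpan b hK'
  rw [← hx', ← hy']
  refine ((eq_iff _ _ _ _).2 ⟨m, e, ?_⟩).symm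
  apply (Types.isLimitEquivSections (hc' m)).injective
  ext k
  simp only [Types.isLimitEquivSections_apply]
  change (q k).app m (c.pt.map e x') = (q k).app m (c.pt.map e y')
  rw [NatTrans.naturality_apply, NatTrans.naturality_apply, ← hde k, Functor.map_comp]
  simp only [ConcreteCategory.comp_apply]
  rw [h]

end Interchange

section Points

open GrothendieckTopology Point Opposite

variable {κ : Cardinal.{u}} [Fact κ.IsRegular] {C : Type u} [SmallCategory C]
  {N : Type u} [SmallCategory N] [InitiallySmall.{u} N] [IsCardinalFiltered Nᵒᵖ κ]

/-- The functor pro-represented by a `κ`-cofiltered diagram preserves limits of size `< κ`. -/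
theorem preservesLimitsOfShape_fiber (D : N ⥤ C) (K : Type u) [SmallCategory K]
    (hK : HasCardinalLT (Arrow K) κ) :
    PreservesLimitsOfShape K (ofIsCofiltered.fiber.{u} D) := by
  have := preservesLimitsOfShape_colim_of_isCardinalFiltered (κ := κ) Nᵒᵖ K hK
  unfold ofIsCofiltered.fiber
  infer_instance

/-- A point of a site whose category of elements is `κ`-cofiltered is a `κ`-point. -/
theorem isKappaPoint_of_isCardinalFiltered {J : GrothendieckTopology C} (p : Point.{u} J)
    [IsCardinalFiltered p.fiber.Elementsᵒᵖ κ] : IsKappaPoint κ p := by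
  intro K _ hK
  have := preservesLimitsOfShape_colim_of_isCardinalFiltered (κ := κ) p.fiber.Elementsᵒᵖ K hK
  unfold sheafFiber presheafFiber
  infer_instance

theorem isCardinalFiltered_elements_fiber [IsCofiltered N] (D : N ⥤ C) :
    IsCardinalFiltered (ofIsCofiltered.fiber.{u} D).Elementsᵒᵖ κ :=
  IsCardinalFiltered.of_final (ofIsCofiltered.functor.{u} D).op κ

end Points

/-! ### Lifting elements along multicomposites -/

theorem hasCardinalLT_arrow_of_mk_lt {κ : Cardinal.{u}} (hκ : Cardinal.aleph0 ≤ κ) {P : Type u}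
    [Preorder P] (hP : Cardinal.mk P < κ) : HasCardinalLT (Arrow P) κ := by
  rw [hasCardinalLT_iff_cardinal_mk_lt]
  refine (Cardinal.mk_le_of_injective (f := fun a : Arrow P => (a.left, a.right)) ?_).trans_lt
    (by simpa using Cardinal.mul_lt_of_lt hκ hP hP)
  rintro ⟨a, b, f⟩ ⟨a', b', f'⟩ h
  obtain ⟨rfl, rfl⟩ := Prod.mk.inj h
  exact congrArg _ (Subsingleton.elim _ _)

namespace IsKappaCotree

variable {κ : Cardinal.{u}} {P : Type u} [PartialOrder P] [OrderTop P]

theorem le_or_le (h : IsKappaCotree κ P) {x y z : P} (hy : x ≤ y) (hz : x ≤ z) :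
    y ≤ z ∨ z ≤ y := by
  obtain ⟨o, -, ⟨e⟩⟩ := h.interval x ⊤ le_top
  exact (le_total (e ⟨y, hy, le_top⟩) (e ⟨z, hz, le_top⟩)).imp e.le_iff_le.1 e.le_iff_le.1

theorem isChain_Ioi (h : IsKappaCotree κ P) (x : P) : IsChain (· ≤ ·) (Set.Ioi x) :=
  fun _ hy _ hz _ => h.le_or_le (le_of_lt hy) (le_of_lt hz)

theorem mk_lt_of_isChain (h : IsKappaCotree κ P) {c : Set P} (hc : IsChain (· ≤ ·) c) :
    Cardinal.mk c < κ := by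
  obtain ⟨m, hm, hcm⟩ := hc.exists_maxChain
  exact (Cardinal.mk_le_mk_of_subset hcm).trans_lt (h.branch m hm)

theorem exists_maximal_notMem (h : IsKappaCotree κ P) {c : Set P} {y : P} (hy : y ∉ c) :
    ∃ x, y ≤ x ∧ x ∉ c ∧ ∀ z, x < z → z ∈ c := by
  obtain ⟨o, -, ⟨e⟩⟩ := h.interval y ⊤ le_top
  have wf : WellFoundedGT (Set.Icc y ⊤) := e.strictMono.wellFoundedGT
  obtain ⟨x, hx, hmax⟩ := wf.wf.has_min {x | x.1 ∉ c} ⟨⟨y, le_rfl, le_top⟩, hy⟩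
  refine ⟨x, x.2.1, hx, fun z hz => ?_⟩
  by_contra hzc
  exact hmax ⟨z, x.2.1.trans hz.le, le_top⟩ hzc hz

end IsKappaCotree

/-- The elements of the values of a functor `E : P ⥤ Type u` on a poset, ordered by
`(x, a) ≤ (y, b)` if `x ≤ y` and `a` is mapped to `b`. -/
structure ElementPoset {P : Type u} [PartialOrder P] (E : P ⥤ Type u) where
  /-- the index -/
  idx : P
  /-- the element -/
  elt : E.obj idx

namespace ElementPoset

variable {P : Type u} [PartialOrder P] {E : P ⥤ Type u}

instance : PartialOrder (ElementPoset E) where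
  le p q := ∃ h : p.idx ≤ q.idx, E.map (homOfLE h) p.elt = q.elt
  le_refl p := ⟨le_rfl, by simp⟩
  le_trans p q r := by
    rintro ⟨h, e⟩ ⟨h', e'⟩
    refine ⟨h.trans h', ?_⟩
    rw [← e', ← e, ← ConcreteCategory.comp_apply, ← Functor.map_comp]
    rfl
  le_antisymm := by
    rintro ⟨p, a⟩ ⟨q, b⟩ ⟨h, e⟩ ⟨h', -⟩
    obtain rfl : p = q := le_antisymm h h'
    simpa using e

theorem eq_of_le {p q : ElementPoset E} (h : p ≤ q) (e : p.idx = q.idx) : p = q := by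
  obtain ⟨p, a⟩ := p
  obtain ⟨q, b⟩ := q
  obtain rfl : p = q := e
  obtain ⟨h, e⟩ := h
  simpa using e

theorem le_of_le_of_le {p q r : ElementPoset E} (hq : p ≤ q) (hr : p ≤ r) (h : q.idx ≤ r.idx) :
    q ≤ r := by
  obtain ⟨h₁, e₁⟩ := hq
  obtain ⟨h₂, e₂⟩ := hr
  refine ⟨h, ?_⟩
  rw [← e₁, ← e₂, ← ConcreteCategory.comp_apply, ← Functor.map_comp]
  rfl

end ElementPoset

section Lift

variable {C : Type u} [SmallCategory C] {κ : Cardinal.{u}} {B : ∀ X : C, Set (Presieve X)}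

theorem isConnected_of_orderTop (P : Type u) [Preorder P] [OrderTop P] : IsConnected P :=
  isConnected_of_isTerminal (C := P) (Preorder.isTerminalTop P)

/-- Let `E` preserve limits of size `< κ`, and send the presieves in `B` to jointly surjective
families. Then it sends multicomposites to jointly surjective families: an element over the root
that is lifted as far as possible is lifted along a whole branch, by continuity at limit height
and by surjectivity elsewhere. -/
theorem KappaCotreeIn.exists_lift_multicomposite (hκ : κ.IsRegular)
    (hC : HasConnectedLimitsLT C κ) (T : KappaCotreeIn κ B) (E : C ⥤ Type u)
    (hE : ∀ (K : Type u) [SmallCategory K], HasCardinalLT (Arrow K) κ →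
      PreservesLimitsOfShape K E)
    (hB : ∀ (Y : C), ∀ R ∈ B Y, ∀ x : E.obj Y, ∃ (Z : C) (f : Z ⟶ Y), R f ∧
      ∃ y, E.map f y = x)
    (x₀ : E.obj (T.F.obj ⊤)) :
    ∃ (Y : C) (f : Y ⟶ T.F.obj ⊤), T.multicomposite f ∧ ∃ y, E.map f y = x₀ := by
  have hP := T.isKappaCotree
  let G := T.F ⋙ E
  -- A subset of a branch gives a limit that is preserved by `E`.
  have exists_glue (c : Set T.P) (hc : IsChain (· ≤ ·) c) (s : Cone (restrictDiagram T.F c))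
      (hs : IsLimit s) (t : ∀ x : c, G.obj x.1)
      (ht : ∀ (x y : c) (h : x.1 ≤ y.1), G.map (homOfLE h) (t x) = t y) :
      ∃ u : E.obj s.pt, ∀ x : c, E.map (s.π.app x) u = t x := by
    have := hE c (hasCardinalLT_arrow_of_mk_lt hκ.aleph0_le (hP.mk_lt_of_isChain hc))
    obtain ⟨u, hu, -⟩ := (Types.isLimit_iff _).1 ⟨isLimitOfPreserves E hs⟩ t
      (fun {x y} f => ht x y (leOfHom f))
    exact ⟨u, hu⟩
  obtain ⟨M, hM, hxM⟩ := (IsChain.singleton (r := (· ≤ ·))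
    (a := (⟨⊤, x₀⟩ : ElementPoset G))).exists_maxChain
  have hroot : (⟨⊤, x₀⟩ : ElementPoset G) ∈ M := hxM rfl
  have mem_of_forall (p : ElementPoset G) (h : ∀ q ∈ M, p ≤ q ∨ q ≤ p) : p ∈ M := by
    have hins : IsChain (· ≤ ·) (insert p M) := hM.1.insert fun q hq _ => h q hq
    exact (hM.2 hins (Set.subset_insert p M)).symm ▸ Set.mem_insert p M
  have total {p q} (hp : p ∈ M) (hq : q ∈ M) : p ≤ q ∨ q ≤ p := hM.1.total hp hq
  let c : Set T.P := {x | ∃ a, (⟨x, a⟩ : ElementPoset G) ∈ M}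
  have hc_chain : IsChain (· ≤ ·) c := by
    rintro x ⟨a, ha⟩ y ⟨b, hb⟩ -
    exact (total ha hb).imp (fun h => h.1) (fun h => h.1)
  have htop : ⊤ ∈ c := ⟨x₀, hroot⟩
  have hup {x y : T.P} (hx : x ∈ c) (hxy : x ≤ y) : y ∈ c := by
    obtain ⟨a, ha⟩ := hx
    have hle : (⟨x, a⟩ : ElementPoset G) ≤ ⟨y, G.map (homOfLE hxy) a⟩ := ⟨hxy, rfl⟩
    refine ⟨_, mem_of_forall ⟨y, G.map (homOfLE hxy) a⟩ fun q hq => ?_⟩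
    rcases total ha hq with h | h
    · exact (hP.le_or_le hxy h.1).imp (ElementPoset.le_of_le_of_le hle h)
        (ElementPoset.le_of_le_of_le h hle)
    · exact Or.inr (h.trans hle)
  choose t htM using fun x : c => x.2
  have t_unique {p : ElementPoset G} (hp : p ∈ M) : p = ⟨p.idx, t ⟨p.idx, p.elt, hp⟩⟩ := by
    rcases total hp (htM ⟨p.idx, p.elt, hp⟩) with h | h
    · exact ElementPoset.eq_of_le h rfl
    · exact (ElementPoset.eq_of_le h rfl).symm
  have t_map (x y : c) (h : x.1 ≤ y.1) : G.map (homOfLE h) (t x) = t y := by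
    rcases total (htM x) (htM y) with h' | h'
    · exact h'.2
    · obtain rfl : x = y := Subtype.ext (le_antisymm h h'.1)
      simp
  -- At a node that is not a leaf, an element of the chain lifts to an immediate predecessor.
  have lift_pred (x : c) (hx : x.1 ∉ T.leaf) : ∃ (y : T.P) (h : y ⋖ x.1) (b : G.obj y),
      G.map (homOfLE h.le) b = t x := by
    obtain ⟨Z, f, ⟨y⟩, b, hb⟩ := hB _ _ (T.predecessors_mem _ hx) (t x)
    exact ⟨y.1, y.2, b, hb⟩
  have mem_of_comparable (y : T.P) (hy : ∀ w ∈ c, y ≤ w ∨ w ≤ y) : y ∈ c := by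
    by_contra hyc
    obtain ⟨x, hyx, hxc, hx⟩ := hP.exists_maximal_notMem hyc
    have hxlt {w : T.P} (hw : w ∈ c) : x < w := by
      have hyw : y ≤ w := (hy w hw).resolve_right fun h => hyc (hup hw h)
      rcases hP.le_or_le hyx hyw with h | h
      · exact lt_of_le_of_ne h fun e => hxc (e ▸ hw)
      · exact absurd (hup hw h) hxc
    have hcx : c = Set.Ioi x := Set.ext fun w => ⟨hxlt, hx w⟩
    have hxmax : ¬ IsMax x := fun h => h.not_lt (hxlt htop)
    by_cases hlim : Order.IsPredLimit x
    · obtain ⟨hs⟩ := T.continuous x hlim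
      obtain ⟨u, hu⟩ := exists_glue _ (hP.isChain_Ioi x) _ hs (fun w => t ⟨w.1, hx _ w.2⟩)
        (fun v w h => t_map ⟨v.1, hx _ v.2⟩ ⟨w.1, hx _ w.2⟩ h)
      refine hxc ⟨u, mem_of_forall _ fun q hq => Or.inl ?_⟩
      rw [t_unique hq]
      exact ⟨(hxlt ⟨_, hq⟩).le, hu ⟨q.idx, hxlt ⟨_, hq⟩⟩⟩
    · obtain ⟨w, hw⟩ : ∃ w, x ⋖ w := by
        by_contra! h
        exact hlim ⟨hxmax, h⟩
      have hwc : w ∈ c := hx w hw.lt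
      obtain ⟨z, hz, b, hb⟩ := lift_pred ⟨w, hwc⟩ fun h => (T.isMin_of_leaf w h).not_lt hw.lt
      have hzM : (⟨z, b⟩ : ElementPoset G) ∈ M := by
        refine mem_of_forall _ fun q hq => Or.inl ?_
        refine le_trans (b := ⟨w, t ⟨w, hwc⟩⟩) ⟨hz.le, hb⟩ ?_
        have hqx := hxlt ⟨_, hq⟩
        rw [t_unique hq]
        have hwq : w ≤ q.idx := by
          rcases hP.le_or_le hw.le hqx.le with h | h
          · exact h
          · exact (h.lt_or_eq.resolve_left fun h' => hw.2 hqx h').ge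
        exact ⟨hwq, t_map ⟨w, hwc⟩ ⟨q.idx, _⟩ hwq⟩
      exact hw.2 (hxlt ⟨b, hzM⟩) hz.lt
  have hc_max : IsMaxChain (· ≤ ·) c := by
    refine ⟨hc_chain, fun d hd hcd => hcd.antisymm fun y hy => mem_of_comparable y fun w hw => ?_⟩
    exact hd.total hy (hcd hw)
  have hleaf (x : T.P) (hx : x ∈ c) (hmin : IsMin x) : x ∈ T.leaf := by
    by_contra h
    obtain ⟨y, hy, -⟩ := lift_pred ⟨x, hx⟩ h
    exact hmin.not_lt hy.lt
  let : OrderTop c := { top := ⟨⊤, htop⟩, le_top := fun x => (le_top : x.1 ≤ ⊤) }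
  have := isConnected_of_orderTop c
  have := hC c (hasCardinalLT_arrow_of_mk_lt hκ.aleph0_le (hP.mk_lt_of_isChain hc_chain))
  let s := limit.cone (restrictDiagram T.F c)
  obtain ⟨u, hu⟩ := exists_glue c hc_chain s (limit.isLimit _) t t_map
  refine ⟨_, s.π.app ⟨⊤, hc_max.top_mem⟩,
    Sieve.le_generate _ _ _ (.mk c hc_max hleaf s (limit.isLimit _)), u, ?_⟩
  refine (hu ⟨⊤, htop⟩).trans ?_
  have h : t ⟨⊤, htop⟩ = x₀ := by simpa using (t_unique hroot).symm
  exact h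

end Lift

/-! ### Well-founded construction of diagrams on posets -/

section WellFoundedDiagram

variable {C : Type u} [SmallCategory C]

namespace ArrowCast

/-- An arrow with prescribed source and target, as a morphism between these. -/
def hom (a : Arrow C) {X Y : C} (hX : a.left = X) (hY : a.right = Y) : X ⟶ Y :=
  eqToHom hX.symm ≫ a.hom ≫ eqToHom hY

theorem mk_hom (a : Arrow C) {X Y : C} (hX : a.left = X) (hY : a.right = Y) :
    Arrow.mk (hom a hX hY) = a := by
  subst hX hY
  simp [hom]

theorem hom_eq_id {a : Arrow C} {A X : C} (ha : a = Arrow.mk (𝟙 A)) (hX : a.left = X)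
    (hY : a.right = X) : hom a hX hY = 𝟙 X := by
  subst ha hX
  simp [hom]

theorem hom_comp {a b c : Arrow C} {A A' A'' : C} {p : A ⟶ A'} {q : A' ⟶ A''}
    (ha : a = Arrow.mk p) (hb : b = Arrow.mk q) (hc : c = Arrow.mk (p ≫ q)) {X Y Z : C}
    (haX : a.left = X) (haY : a.right = Y) (hbY : b.left = Y) (hbZ : b.right = Z)
    (hcX : c.left = X) (hcZ : c.right = Z) :
    hom c hcX hcZ = hom a haX haY ≫ hom b hbY hbZ := by
  subst ha hb hc
  dsimp at haX haY hbZ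
  subst haX haY hbZ
  simp [hom]

end ArrowCast

/-- A table of arrows indexed by a preorder comes from a functor as soon as it is compatible with
identities and composition. -/
theorem exists_functor_of_table {U : Type u} [Preorder U] (m : U → U → Arrow C)
    (hid : ∀ x, ∃ A : C, m x x = Arrow.mk (𝟙 A))
    (hcomp : ∀ x y z, x ≤ y → y ≤ z → ∃ (A A' A'' : C) (p : A ⟶ A') (q : A' ⟶ A''),
      m x y = Arrow.mk p ∧ m y z = Arrow.mk q ∧ m x z = Arrow.mk (p ≫ q)) :
    ∃ F : U ⥤ C, ∀ (z w : U) (hzw : z ≤ w), Arrow.mk (F.map (homOfLE hzw)) = m z w := by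
  have left_eq {z w : U} (hzw : z ≤ w) : (m z w).left = (m z z).left := by
    obtain ⟨A, A', A'', p, q, h₁, h₂, h₃⟩ := hcomp z z w le_rfl hzw
    rw [h₁, h₃]; rfl
  have right_eq {z w : U} (hzw : z ≤ w) : (m z w).right = (m w w).left := by
    obtain ⟨A, A', A'', p, q, h₁, h₂, h₃⟩ := hcomp z w w hzw le_rfl
    rw [h₁, h₂]; rfl
  refine ⟨{ obj := fun z => (m z z).left
            map := fun {z w} f => ArrowCast.hom (m z w) (left_eq (leOfHom f)) (right_eq (leOfHom f))
            map_id := fun z => ArrowCast.hom_eq_id (hid z).choose_spec _ _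
            map_comp := fun {x y z} f g => ?_ }, fun z w hzw =>
    ArrowCast.mk_hom (m z w) (left_eq hzw) (right_eq hzw)⟩
  obtain ⟨A, A', A'', p, q, h₁, h₂, h₃⟩ := hcomp x y z (leOfHom f) (leOfHom g)
  exact ArrowCast.hom_comp h₁ h₂ h₃ _ _ _ _ _ _

theorem cone_eq_of_arrow_eq {K : Type u} [SmallCategory K] {H : K ⥤ C} {c c' : Cone H}
    (hpt : c.pt = c'.pt) (h : ∀ k, Arrow.mk (c.π.app k) = Arrow.mk (c'.π.app k)) : c = c' := by
  obtain ⟨A, π⟩ := c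
  obtain ⟨A', π'⟩ := c'
  obtain rfl : A = A' := hpt
  congr 1
  ext k
  exact Arrow.mk_injective _ _ (h k)

/-- A diagram on a poset with well-founded `>` can be built node by node: if every diagram on
the nodes strictly above `x` is given a cone, then there is a diagram on the whole poset in which
every node is the apex of the cone given over the nodes above it. -/
theorem exists_functor_coneAbove_eq [Nonempty C] {T : Type u} [PartialOrder T] [WellFoundedGT T]
    (step : ∀ (x : T) (H : Set.Ioi x ⥤ C), Cone H) :
    ∃ F : T ⥤ C, ∀ x, coneAbove F x = step x (restrictDiagram F (Set.Ioi x)) := by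
  classical
  -- The diagram is encoded by its table of arrows `T → T → Arrow C`, which makes sense before
  -- functoriality is known; the row at `x` is defined in terms of the rows at the nodes above.
  let IsTable (x : T) (m : ∀ y, x < y → T → Arrow C) (H : Set.Ioi x ⥤ C) : Prop :=
    ∀ (y z : Set.Ioi x) (h : y ≤ z), Arrow.mk (H.map (homOfLE h)) = m y y.2 z
  have table_unique (x : T) (m) {H H' : Set.Ioi x ⥤ C} (hH : IsTable x m H)
      (hH' : IsTable x m H') : H = H' :=
    Arrow.functor_ext fun y z f => (hH y z (leOfHom f)).trans (hH' y z (leOfHom f)).symm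
  let coneRow (x : T) (H : Set.Ioi x ⥤ C) (z : T) : Arrow C :=
    if hz : x < z then Arrow.mk ((step x H).π.app ⟨z, hz⟩) else Arrow.mk (𝟙 (step x H).pt)
  let row (x : T) (m : ∀ y, x < y → T → Arrow C) : T → Arrow C :=
    if h : ∃ H, IsTable x m H then coneRow x h.choose
    else fun _ => Arrow.mk (𝟙 (Classical.arbitrary C))
  let m : T → T → Arrow C := (wellFounded_gt (α := T)).fix row
  have m_eq {x : T} {H : Set.Ioi x ⥤ C} (hH : IsTable x (fun y _ => m y) H) :
      m x = coneRow x H := by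
    have hex : ∃ H, IsTable x (fun y _ => m y) H := ⟨H, hH⟩
    have h1 : m x = row x (fun y _ => m y) := WellFounded.fix_eq _ _ _
    rw [h1, show row x (fun y _ => m y) = coneRow x hex.choose from dif_pos hex,
      table_unique x (fun y _ => m y) hex.choose_spec hH]
  have coneRow_self (x : T) (H) : coneRow x H x = Arrow.mk (𝟙 (step x H).pt) :=
    dif_neg (lt_irrefl x)
  have coneRow_lt (x : T) (H) {z : T} (hz : x < z) :
      coneRow x H z = Arrow.mk ((step x H).π.app ⟨z, hz⟩) := dif_pos hz
  have key (x : T) : (∃ A : C, m x x = Arrow.mk (𝟙 A)) ∧ ∀ y z, x ≤ y → y ≤ z →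
      ∃ (A A' A'' : C) (p : A ⟶ A') (q : A' ⟶ A''),
        m x y = Arrow.mk p ∧ m y z = Arrow.mk q ∧ m x z = Arrow.mk (p ≫ q) := by
    induction x using (wellFounded_gt (α := T)).induction with
    | _ x ih =>
    obtain ⟨H, hH⟩ := exists_functor_of_table (U := Set.Ioi x) (fun y z => m y z)
      (fun y => (ih y y.2).1) (fun y z w hyz hzw => (ih y y.2).2 z w hyz hzw)
    have hx := m_eq hH
    have hxx : m x x = Arrow.mk (𝟙 (step x H).pt) := by rw [hx, coneRow_self]
    refine ⟨⟨_, hxx⟩, fun y z hxy hyz => ?_⟩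
    rcases hxy.eq_or_lt with rfl | hxy
    · rcases hyz.eq_or_lt with rfl | hyz
      · exact ⟨_, _, _, 𝟙 _, 𝟙 _, hxx, hxx, by rw [hxx, Category.comp_id]⟩
      · have := (congrFun hx z).trans (coneRow_lt x H hyz)
        exact ⟨_, _, _, 𝟙 _, _, hxx, this, by rw [this, Category.id_comp]⟩
    · have hxz := hxy.trans_le hyz
      refine ⟨_, _, _, (step x H).π.app ⟨y, hxy⟩, H.map (homOfLE (show (⟨y, hxy⟩ : Set.Ioi x) ≤
        ⟨z, hxz⟩ from hyz)), by rw [hx, coneRow_lt],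
        (hH ⟨y, hxy⟩ ⟨z, hxz⟩ hyz).symm, ?_⟩
      rw [Cone.w, hx, coneRow_lt]
  obtain ⟨F, hF⟩ := exists_functor_of_table m (fun x => (key x).1) (fun x => (key x).2)
  refine ⟨F, fun x => ?_⟩
  have hx := m_eq (x := x) (H := restrictDiagram F (Set.Ioi x))
    (fun y z h => hF y z h)
  refine cone_eq_of_arrow_eq ?_ fun k => ?_
  · have := ((hF x x le_rfl).trans (congrFun hx x)).trans (coneRow_self x _)
    exact congrArg (fun a : Arrow C => a.left) this
  · exact ((hF x k (le_of_lt k.2)).trans (congrFun hx k)).trans (coneRow_lt x _ k.2)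

end WellFoundedDiagram

/-! ### The tree of transfinite sequences -/

/-- A sequence of elements of `A` whose length is an element of the well-order `O`. The entries
beyond the length are set to the default value, so that sequences are equal when their lengths
and their entries below the length are. -/
structure SeqTree (O : Type u) [LinearOrder O] (A : Type u) [Inhabited A] where
  /-- the length -/
  len : O
  /-- the entries -/
  val : O → A
  val_of_le : ∀ i, len ≤ i → val i = default

namespace SeqTree

variable {O : Type u} [LinearOrder O] {A : Type u} [Inhabited A]

/-- Sequences are ordered by reverse extension, so that the empty sequence is the root. -/
instance : PartialOrder (SeqTree O A) where
  le x y := y.len ≤ x.len ∧ ∀ i < y.len, x.val i = y.val i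
  le_refl x := ⟨le_rfl, fun _ _ => rfl⟩
  le_trans x y z h h' := ⟨h'.1.trans h.1, fun i hi =>
    (h.2 i (hi.trans_le h'.1)).trans (h'.2 i hi)⟩
  le_antisymm := by
    rintro ⟨l, v, hv⟩ ⟨l', v', hv'⟩ ⟨h, e⟩ ⟨h', -⟩
    obtain rfl : l = l' := le_antisymm h' h
    obtain rfl : v = v' := funext fun i => by
      rcases lt_or_ge i l with hi | hi
      · exact e i hi
      · rw [hv i hi, hv' i hi]
    rfl

instance [OrderBot O] : OrderTop (SeqTree O A) where
  top := ⟨⊥, fun _ => default, fun _ _ => rfl⟩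
  le_top _ := ⟨bot_le, fun _ hi => absurd hi not_lt_bot⟩

variable {x y z : SeqTree O A}

theorem len_le_of_le (h : x ≤ y) : y.len ≤ x.len := h.1

theorem le_of_le_of_le (hy : x ≤ y) (hz : x ≤ z) (h : z.len ≤ y.len) : y ≤ z :=
  ⟨h, fun i hi => (hy.2 i (hi.trans_le h)).symm.trans (hz.2 i hi)⟩

theorem eq_of_le_of_len_le (h : x ≤ y) (h' : x.len ≤ y.len) : x = y :=
  le_antisymm h (le_of_le_of_le h le_rfl h')

theorem len_lt_of_lt (h : x < y) : y.len < x.len :=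
  lt_of_not_ge fun h' => h.ne (eq_of_le_of_len_le h.le h')

theorem lt_of_le_of_len_lt (h : x ≤ y) (h' : y.len < x.len) : x < y :=
  lt_of_le_of_ne h fun e => h'.ne (e ▸ rfl)

instance [WellFoundedLT O] : WellFoundedGT (SeqTree O A) :=
  ⟨Subrelation.wf (r := InvImage (· < ·) len) (fun h => len_lt_of_lt h)
    (InvImage.wf len wellFounded_lt)⟩

/-- The initial segment of length `γ` of a full sequence. -/
def ofFun (σ : O → A) (γ : O) : SeqTree O A where
  len := γ
  val i := if i < γ then σ i else default
  val_of_le _ hi := if_neg hi.not_gt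

theorem ofFun_val {σ : O → A} {γ i : O} (h : i < γ) : (ofFun σ γ).val i = σ i := if_pos h

theorem ofFun_antitone (σ : O → A) : Antitone (ofFun σ) := fun _ _ h =>
  ⟨h, fun _ hi => (ofFun_val (lt_of_lt_of_le hi h)).trans (ofFun_val hi).symm⟩

theorem eq_ofFun {σ : O → A} (h : ∀ i < x.len, x.val i = σ i) : x = ofFun σ x.len :=
  eq_of_le_of_len_le ⟨le_rfl, fun i hi => (h i hi).trans (ofFun_val hi).symm⟩ le_rfl

theorem le_ofFun_val {γ : O} (h : γ ≤ x.len) : x ≤ ofFun x.val γ :=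
  ⟨h, fun _ hi => (ofFun_val hi).symm⟩

theorem len_covBy_len (h : x ⋖ y) : y.len ⋖ x.len :=
  ⟨len_lt_of_lt h.lt, fun γ h₁ h₂ => by
    have hx : x ≤ ofFun x.val γ := le_ofFun_val h₂.le
    exact h.2 (lt_of_le_of_len_lt hx h₂)
      (lt_of_le_of_len_lt (le_of_le_of_le hx h.le h₁.le) h₁)⟩

theorem covBy_of_len_covBy_len (h : x ≤ y) (h' : y.len ⋖ x.len) : x ⋖ y :=
  ⟨lt_of_le_of_len_lt h h'.lt, fun _ h₁ h₂ => h'.2 (len_lt_of_lt h₂) (len_lt_of_lt h₁)⟩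

theorem le_of_covBy_of_lt (h : x ⋖ y) (hz : x < z) : y ≤ z :=
  le_of_le_of_le h.le hz.le (not_lt.1 fun h' => (len_covBy_len h).2 h' (len_lt_of_lt hz))

theorem mk_le_of_forall_len_mem {c : Set (SeqTree O A)} (hc : IsChain (· ≤ ·) c) {s : Set O}
    (hs : ∀ x ∈ c, x.len ∈ s) : Cardinal.mk c ≤ Cardinal.mk s := by
  refine Cardinal.mk_le_of_injective (f := fun x : c => (⟨x.1.len, hs _ x.2⟩ : s)) ?_
  intro x y h
  have h : x.1.len = y.1.len := congrArg Subtype.val h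
  refine Subtype.ext ?_
  rcases hc.total x.2 y.2 with h' | h'
  · exact eq_of_le_of_len_le h' h.le
  · exact (eq_of_le_of_len_le h' h.ge).symm

theorem isChain_Ici (x : SeqTree O A) : IsChain (· ≤ ·) (Set.Ici x) := fun y hy z hz _ =>
  (le_total z.len y.len).imp (le_of_le_of_le hy hz) (le_of_le_of_le hz hy)

/-- The members of a chain are initial segments of one full sequence. -/
theorem exists_ofFun_of_isChain {c : Set (SeqTree O A)} (hc : IsChain (· ≤ ·) c) :
    ∃ σ : O → A, ∀ x ∈ c, x = ofFun σ x.len := by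
  classical
  refine ⟨fun i => if h : ∃ x ∈ c, i < x.len then h.choose.val i else default,
    fun x hx => eq_ofFun fun i hi => ?_⟩
  have h : ∃ x ∈ c, i < x.len := ⟨x, hx, hi⟩
  rw [dif_pos h]
  rcases hc.total hx h.choose_spec.1 with h' | h'
  · exact h'.2 i h.choose_spec.2
  · exact (h'.2 i hi).symm

/-- An interval in an upper set of the tree of sequences is the dual of an interval of `O`. -/
theorem exists_interval_orderIso {κ : Cardinal.{u}} [WellFoundedLT O]
    {U : Set (SeqTree O A)} (hU : IsUpperSet U)
    (hO : ∀ i : O, Cardinal.mk (Set.Iic i) < κ) {x y : U} (h : x ≤ y) :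
    ∃ o : Ordinal.{u}, o < κ.ord ∧ Nonempty (Set.Icc x y ≃o (Set.Iio o)ᵒᵈ) := by
  let W := Set.Icc y.1.len x.1.len
  refine ⟨Ordinal.type (α := W) (· < ·), ?_, ⟨?_⟩⟩
  · rw [Cardinal.lt_ord, Ordinal.card_type]
    exact (Cardinal.mk_le_mk_of_subset Set.Icc_subset_Iic_self).trans_lt (hO x.1.len)
  · let f (z : Set.Icc x y) : Wᵒᵈ :=
      OrderDual.toDual ⟨z.1.1.len, len_le_of_le z.2.2, len_le_of_le z.2.1⟩
    have hf (z z' : Set.Icc x y) : f z ≤ f z' ↔ z ≤ z' :=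
      ⟨fun h => le_of_le_of_le (x := x.1) z.2.1 z'.2.1 h, fun h => len_le_of_le h⟩
    have hinj : Function.Injective f := fun z z' h =>
      le_antisymm ((hf z z').1 h.le) ((hf z' z).1 h.ge)
    have hsurj : Function.Surjective f := by
      intro γ
      obtain ⟨⟨γ, h₁, h₂⟩, rfl⟩ := OrderDual.toDual.surjective γ
      have hx : x.1 ≤ ofFun x.1.val γ := le_ofFun_val h₂
      refine ⟨⟨⟨ofFun x.1.val γ, hU hx x.2⟩, hx, ?_⟩, rfl⟩
      exact le_of_le_of_le hx h h₁
    let e : Set.Icc x y ≃o Wᵒᵈ :=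
      { toEquiv := Equiv.ofBijective f ⟨hinj, hsurj⟩
        map_rel_iff' := fun {z z'} => hf z z' }
    exact e.trans (OrderIso.dual (OrderIso.ofRelIsoLT (Ordinal.enum (α := W) (· < ·))).symm)

end SeqTree

section LabelledDiagram

variable {C : Type u} [SmallCategory C] {κ : Cardinal.{u}}
  {O : Type u} [LinearOrder O] [OrderBot O] [WellFoundedLT O]

/-- There is a diagram on the tree of all sequences of arrows of `C` which is continuous at limit
height, and which sends the extension of `y` by a single arrow `a` to `a` whenever the target of
`a` is the value of the diagram at `y`. (When it is not, the value does not matter.) -/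
theorem exists_labelled_diagram (hκ : κ.IsRegular) (hC : HasConnectedLimitsLT C κ)
    (hO : ∀ i : O, Cardinal.mk (Set.Iio i) < κ) [Inhabited (Arrow C)] (X : C) :
    ∃ F : SeqTree O (Arrow C) ⥤ C, F.obj ⊤ = X ∧
      (∀ x, Order.IsPredLimit x → Nonempty (IsLimit (coneAbove F x))) ∧
      ∀ x y (h : x ⋖ y) (Z : C) (a : Z ⟶ F.obj y), x.val y.len = Arrow.mk a →
        Arrow.mk (F.map (homOfLE h.le)) = Arrow.mk a := by
  have : Nonempty C := ⟨X⟩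
  have exists_step (x : SeqTree O (Arrow C)) (H : Set.Ioi x ⥤ C) : ∃ c : Cone H,
      (IsMax x → c.pt = X) ∧ (Order.IsPredLimit x → Nonempty (IsLimit c)) ∧
      ∀ y (h : x ⋖ y) (Z : C) (a : Z ⟶ H.obj ⟨y, h.lt⟩), x.val y.len = Arrow.mk a →
        Arrow.mk (c.π.app ⟨y, h.lt⟩) = Arrow.mk a := by
    by_cases hmax : IsMax x
    · have hempty (z : Set.Ioi x) : False := hmax.not_lt z.2
      exact ⟨{ pt := X
               π := { app := fun z => (hempty z).elim
                      naturality := fun z => (hempty z).elim } },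
        fun _ => rfl, fun h => absurd hmax h.1, fun y h => absurd h.lt hmax.not_lt⟩
    by_cases hlim : Order.IsPredLimit x
    · have hx : x < ⊤ := lt_of_le_of_ne le_top fun e => hmax (e ▸ isMax_top)
      let : OrderTop (Set.Ioi x) := { top := ⟨⊤, hx⟩, le_top := fun z => (le_top : z.1 ≤ ⊤) }
      have := isConnected_of_orderTop (Set.Ioi x)
      have hcard : Cardinal.mk (Set.Ioi x) < κ :=
        (SeqTree.mk_le_of_forall_len_mem ((SeqTree.isChain_Ici x).mono Set.Ioi_subset_Ici_self)
          (s := Set.Iio x.len) fun z hz => SeqTree.len_lt_of_lt hz).trans_lt (hO _)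
      have := hC (Set.Ioi x) (hasCardinalLT_arrow_of_mk_lt hκ.aleph0_le hcard)
      exact ⟨limit.cone H, fun h => absurd h hmax, fun _ => ⟨limit.isLimit H⟩,
        fun y h => absurd h (hlim.2 y)⟩
    obtain ⟨y, hy⟩ : ∃ y, x ⋖ y := by
      by_contra! h
      exact hlim ⟨hmax, h⟩
    have hle (z : Set.Ioi x) : (⟨y, hy.lt⟩ : Set.Ioi x) ≤ z := SeqTree.le_of_covBy_of_lt hy z.2
    let stepCone {Z : C} (a : Z ⟶ H.obj ⟨y, hy.lt⟩) : Cone H :=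
      { pt := Z
        π := { app := fun z => a ≫ H.map (homOfLE (hle z))
               naturality := fun z w f => by
                simp only [Functor.const_obj_obj, Functor.const_obj_map, Category.id_comp,
                  Category.assoc, ← Functor.map_comp]
                rfl } }
    have hunique (z) (h : x ⋖ z) : z = y := le_antisymm
      (SeqTree.le_of_covBy_of_lt h hy.lt) (SeqTree.le_of_covBy_of_lt hy h.lt)
    by_cases hlabel : ∃ (Z : C) (a : Z ⟶ H.obj ⟨y, hy.lt⟩), x.val y.len = Arrow.mk a
    · obtain ⟨Z, a, ha⟩ := hlabel
      refine ⟨stepCone a, fun h => absurd h hmax, fun h => absurd h hlim, fun z h Z' a' h' => ?_⟩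
      obtain rfl := hunique z h
      rw [← h', ha]
      congr 1
      exact (congrArg (a ≫ ·) (H.map_id _)).trans (Category.comp_id a)
    · refine ⟨stepCone (𝟙 _), fun h => absurd h hmax, fun h => absurd h hlim,
        fun z h Z' a' h' => ?_⟩
      obtain rfl := hunique z h
      exact absurd ⟨Z', a', h'⟩ hlabel
  choose step h_top h_lim h_step using exists_step
  obtain ⟨F, hF⟩ := exists_functor_coneAbove_eq step
  refine ⟨F, ?_, fun x hx => ?_, fun x y h Z a ha => ?_⟩
  · rw [← h_top ⊤ (restrictDiagram F _) isMax_top, ← hF]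
    rfl
  · rw [hF]
    exact h_lim x _ hx
  · have := h_step x (restrictDiagram F _) y h Z a ha
    rwa [← hF] at this

end LabelledDiagram

/-! ### The subtree of admissible sequences -/

section MemArrow

variable {C : Type u} [SmallCategory C] {Y : C}

/-- The arrow `a` is (equal to) a member of the presieve `R`. -/
def MemArrow (R : Presieve Y) (a : Arrow C) : Prop :=
  ∃ (Z : C) (f : Z ⟶ Y), R f ∧ a = Arrow.mk f

theorem memArrow_mk_iff {R : Presieve Y} {Z : C} {f : Z ⟶ Y} :
    MemArrow R (Arrow.mk f) ↔ R f := by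
  refine ⟨?_, fun h => ⟨Z, f, h, rfl⟩⟩
  rintro ⟨Z', f', h, e⟩
  obtain rfl : Z = Z' := congrArg (fun a : Arrow C => a.left) e
  obtain rfl := Arrow.mk_injective _ _ e
  exact h

end MemArrow

section RestrictDiagram

variable {C : Type u} [SmallCategory C] {P : Type u} [PartialOrder P] {U : Set P}

theorem covBy_coe_iff (hU : IsUpperSet U) {x y : U} : x.1 ⋖ y.1 ↔ x ⋖ y :=
  ⟨fun h => ⟨h.lt, fun z h₁ h₂ => h.2 (c := z.1) h₁ h₂⟩,
    fun h => ⟨h.lt, fun z h₁ h₂ => h.2 (c := ⟨z, hU h₁.le x.2⟩) h₁ h₂⟩⟩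

theorem isPredLimit_coe (hU : IsUpperSet U) {x : U} (h : Order.IsPredLimit x) :
    Order.IsPredLimit x.1 :=
  ⟨fun h' => h.1 fun y hy => h' (b := y.1) hy,
    fun y hy => h.2 ⟨y, hU hy.lt.le x.2⟩ ((covBy_coe_iff hU).1 hy)⟩

/-- Continuity of a diagram on a poset is inherited by its restriction to an upper set. -/
theorem nonempty_isLimit_coneAbove_restrictDiagram (hU : IsUpperSet U) (F : P ⥤ C) (x : U)
    (h : IsLimit (coneAbove F x.1)) :
    Nonempty (IsLimit (coneAbove (restrictDiagram F U) x)) := by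
  let up (y : Set.Ioi x.1) : Set.Ioi x := ⟨⟨y.1, hU (le_of_lt y.2) x.2⟩, y.2⟩
  let ext (s : Cone (restrictDiagram (restrictDiagram F U) (Set.Ioi x))) :
      Cone (restrictDiagram F (Set.Ioi x.1)) :=
    { pt := s.pt
      π := { app := fun y => s.π.app (up y)
             naturality := fun y z f =>
              s.π.naturality (X := up y) (Y := up z) (homOfLE (leOfHom f)) } }
  exact ⟨{ lift := fun s => h.lift (ext s)
           fac := fun s y => h.fac (ext s) ⟨y.1.1, y.2⟩
           uniq := fun s m hm => h.uniq (ext s) m fun y => hm (up y) }⟩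

end RestrictDiagram

section Admissible

variable {C : Type u} [SmallCategory C] {κ : Cardinal.{u}}
  {O : Type u} [LinearOrder O] [OrderBot O] [Inhabited (Arrow C)]
  (F : SeqTree O (Arrow C) ⥤ C) (S : Sieve (F.obj ⊤)) (R : ∀ x, Presieve (F.obj x))

/-- A sequence of arrows is admissible if the composites of its proper initial segments stay out
of the sieve `S` on the root, and each of its entries is a member of the presieve that `R`
assigns to the initial segment before it. -/
def admissible : Set (SeqTree O (Arrow C)) :=
  {x | ∀ y, x < y → ¬ S (F.map (homOfLE (le_top : y ≤ ⊤))) ∧ MemArrow (R y) (x.val y.len)}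

variable {F S R}

theorem isUpperSet_admissible : IsUpperSet (admissible F S R) := by
  intro x x' h hx y hy
  rw [← h.2 _ (SeqTree.len_lt_of_lt hy)]
  exact hx y (h.trans_lt hy)

theorem top_mem_admissible : ⊤ ∈ admissible F S R :=
  fun _ hy => absurd hy not_top_lt

theorem ofFun_mem_admissible {σ : O → Arrow C} {γ : O}
    (h : ∀ δ < γ, ∃ δ', δ < δ' ∧ SeqTree.ofFun σ δ' ∈ admissible F S R) :
    SeqTree.ofFun σ γ ∈ admissible F S R := by
  intro y hy
  have hlen : y.len < γ := SeqTree.len_lt_of_lt hy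
  obtain ⟨δ', hδ', hx⟩ := h _ hlen
  have hσ (i) (hi : i < y.len) : y.val i = σ i :=
    (hy.le.2 i hi).symm.trans (SeqTree.ofFun_val (hi.trans hlen))
  have hxy : SeqTree.ofFun σ δ' ≤ y :=
    ⟨hδ'.le, fun i hi => (SeqTree.ofFun_val (hi.trans hδ')).trans (hσ i hi).symm⟩
  have := hx y (SeqTree.lt_of_le_of_len_lt hxy hδ')
  rwa [SeqTree.ofFun_val hδ', ← SeqTree.ofFun_val (σ := σ) (γ := γ) hlen] at this

/-- The lengths in a chain of admissible sequences are bounded, if no full sequence has all its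
initial segments admissible. -/
theorem exists_len_le_of_isChain
    (hno : ¬ ∃ σ : O → Arrow C, ∀ γ, SeqTree.ofFun σ γ ∈ admissible F S R)
    {c : Set (SeqTree O (Arrow C))} (hc : IsChain (· ≤ ·) c) (hcU : c ⊆ admissible F S R) :
    ∃ γ : O, ∀ x ∈ c, x.len ≤ γ := by
  by_contra! h
  obtain ⟨σ, hσ⟩ := SeqTree.exists_ofFun_of_isChain hc
  refine hno ⟨σ, fun γ => ofFun_mem_admissible fun δ _ => ?_⟩
  obtain ⟨x, hx, hδ⟩ := h δ
  exact ⟨x.len, hδ, hσ x hx ▸ hcU hx⟩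

variable [WellFoundedLT O]

/-- A bounded chain of admissible sequences has an admissible lower bound. -/
theorem exists_le_of_isChain {c : Set (SeqTree O (Arrow C))} (hc : IsChain (· ≤ ·) c)
    (hcU : c ⊆ admissible F S R) (hbdd : ∃ γ : O, ∀ x ∈ c, x.len ≤ γ) :
    ∃ x ∈ admissible F S R, ∀ y ∈ c, x ≤ y := by
  obtain ⟨σ, hσ⟩ := SeqTree.exists_ofFun_of_isChain hc
  obtain ⟨γ, hγ, hmin⟩ := (wellFounded_lt (α := O)).has_min {γ : O | ∀ x ∈ c, x.len ≤ γ} hbdd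
  refine ⟨SeqTree.ofFun σ γ, ofFun_mem_admissible fun δ hδ => ?_, fun y hy => ?_⟩
  · by_contra! h
    refine hmin δ (fun x hx => ?_) hδ
    by_contra! hlt
    exact h x.len hlt (hσ x hx ▸ hcU hx)
  · rw [hσ y hy]
    exact SeqTree.ofFun_antitone σ (hγ y hy)

variable [NoMaxOrder O]

/-- If no full sequence has all its initial segments admissible, the admissible sequences form a
`κ`-cotree whose multicomposite is contained in `S`: its leaves are the sequences with composite
in `S`. -/
theorem exists_isMulticomposite_le {B : ∀ X : C, Set (Presieve X)}
    (hO : ∀ i : O, Cardinal.mk (Set.Iio i) < κ)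
    (hlim : ∀ x, Order.IsPredLimit x → Nonempty (IsLimit (coneAbove F x)))
    (hlabel : ∀ x y (h : x ⋖ y) (Z : C) (a : Z ⟶ F.obj y), x.val y.len = Arrow.mk a →
      Arrow.mk (F.map (homOfLE h.le)) = Arrow.mk a)
    (hR : ∀ x, R x ∈ B (F.obj x))
    (hno : ¬ ∃ σ : O → Arrow C, ∀ γ, SeqTree.ofFun σ γ ∈ admissible F S R) :
    ∃ M : Sieve (F.obj ⊤), IsMulticomposite κ B M ∧ M ≤ S := by
  let U := admissible F S R
  have hU : IsUpperSet U := isUpperSet_admissible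
  have hO' (i : O) : Cardinal.mk (Set.Iic i) < κ := by
    obtain ⟨j, hj⟩ := exists_gt i
    exact (Cardinal.mk_le_mk_of_subset (Set.Iic_subset_Iio.2 hj)).trans_lt (hO j)
  let leaf : Set U := {x | S (F.map (homOfLE (le_top : x.1 ≤ ⊤)))}
  have hchain {c : Set U} (hc : IsChain (· ≤ ·) c) :
      IsChain (· ≤ ·) (Subtype.val '' c) ∧ Subtype.val '' c ⊆ U :=
    ⟨by
      rintro _ ⟨x, hx, rfl⟩ _ ⟨y, hy, rfl⟩ -
      exact hc.total hx hy, by rintro _ ⟨x, -, rfl⟩; exact x.2⟩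
  let : OrderTop U := { top := ⟨⊤, top_mem_admissible⟩, le_top := fun x => (le_top : x.1 ≤ ⊤) }
  have hcotree : IsKappaCotree κ U :=
    { interval := fun x y h => SeqTree.exists_interval_orderIso hU hO' h
      branch := fun c hc => by
        obtain ⟨h₁, h₂⟩ := hchain hc.1
        obtain ⟨γ, hγ⟩ := exists_len_le_of_isChain hno h₁ h₂
        rw [← Cardinal.mk_image_eq (s := c) Subtype.val_injective]
        exact (SeqTree.mk_le_of_forall_len_mem h₁ (s := Set.Iic γ) hγ).trans_lt (hO' γ) }
  have hpred (x : U) (hx : x ∉ leaf) : predecessors (restrictDiagram F U) x = R x.1 := by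
    apply le_antisymm
    · rintro _ _ ⟨y⟩
      have hyx : y.1.1 ⋖ x.1 := (covBy_coe_iff hU).2 y.2
      obtain ⟨-, Z, f, hf, e⟩ := y.1.2 x.1 hyx.lt
      refine memArrow_mk_iff.1 ⟨Z, f, hf, hlabel _ _ hyx Z f e⟩
    · intro Z f hf
      obtain ⟨δ, hδ⟩ := exists_covBy_of_wellFoundedLT (not_isMax x.1.len)
      let σ (i : O) : Arrow C := if i < x.1.len then x.1.val i else Arrow.mk f
      let y := SeqTree.ofFun σ δ
      have hyx : y ≤ x.1 := ⟨hδ.le, fun i hi => (SeqTree.ofFun_val (hi.trans hδ.lt)).trans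
        (if_pos hi)⟩
      have hval : y.val x.1.len = Arrow.mk f :=
        (SeqTree.ofFun_val hδ.lt).trans (if_neg (lt_irrefl _))
      have hcov : y ⋖ x.1 := SeqTree.covBy_of_len_covBy_len hyx hδ
      have hy : y ∈ U := fun z hz => by
        have hxz : x.1 ≤ z := SeqTree.le_of_covBy_of_lt hcov hz
        rcases hxz.eq_or_lt with rfl | hlt
        · exact ⟨hx, hval ▸ memArrow_mk_iff.2 hf⟩
        · rw [hyx.2 _ (SeqTree.len_lt_of_lt hlt)]
          exact x.2 z hlt
      have hmem : predecessors (restrictDiagram F U) x (F.map (homOfLE hcov.le)) :=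
        Presieve.ofArrows.mk (⟨⟨y, hy⟩, (covBy_coe_iff hU).1 hcov⟩ : {y : U // y ⋖ x})
      obtain ⟨Z', g, hg, e⟩ := memArrow_mk_iff.2 hmem
      exact memArrow_mk_iff.1 ⟨Z', g, hg, (hlabel y x.1 hcov Z f hval).symm.trans e⟩
  let T : KappaCotreeIn κ B :=
    { P := U
      isKappaCotree := hcotree
      F := restrictDiagram F U
      continuous := fun x hx => by
        obtain ⟨h⟩ := hlim _ (isPredLimit_coe hU hx)
        exact nonempty_isLimit_coneAbove_restrictDiagram hU F x h
      leaf := leaf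
      isMin_of_leaf := fun x hx y hy => by
        by_contra h
        exact (y.2 x.1 (lt_of_le_not_ge hy h)).1 hx
      predecessors_mem := fun x hx => by
        rw [hpred x hx]
        exact hR _ }
  refine ⟨T.multicomposite, .mk T, (Sieve.generate_le_iff (X := F.obj ⊤) T.BranchLimits S).2 ?_⟩
  rintro _ _ ⟨c, hc, hleaf, s, hs⟩
  have mem_of_le (x : U) (hx : ∀ y ∈ c, x ≤ y) : x ∈ c := by
    have hins : IsChain (· ≤ ·) (insert x c) := hc.1.insert fun y hy _ => Or.inl (hx y hy)
    exact (hc.2 hins (Set.subset_insert x c)).symm ▸ Set.mem_insert x c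
  -- A branch has a least element, which has to be a leaf.
  obtain ⟨h₁, h₂⟩ := hchain hc.1
  obtain ⟨x, hxU, hx⟩ := exists_le_of_isChain h₁ h₂ (exists_len_le_of_isChain hno h₁ h₂)
  have hle (y : U) (hy : y ∈ c) : (⟨x, hxU⟩ : U) ≤ y := hx y.1 (Set.mem_image_of_mem _ hy)
  have hxc := mem_of_le _ hle
  have hmin : IsMin (⟨x, hxU⟩ : U) := fun y hy => hle y (mem_of_le y fun z hz => hy.trans (hle z hz))
  have hxS : S (F.map (homOfLE (le_top : x ≤ ⊤))) := hleaf _ hxc hmin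
  have hw := s.w (j := ⟨⟨x, hxU⟩, hxc⟩) (j' := ⟨⊤, hc.top_mem⟩)
    (homOfLE (le_top : (⟨x, hxU⟩ : U) ≤ ⊤))
  rw [← hw]
  exact S.downward_closed hxS _

end Admissible

/-! ### The branch avoiding a sieve that is not covering -/

section Branch

variable {C : Type u} [SmallCategory C] {J : GrothendieckTopology C} {κ : Cardinal.{u}}
  {B : ∀ X : C, Set (Presieve X)}
  {O : Type u} [LinearOrder O]

/-- Every task `(α, i)` is scheduled at arbitrarily late times. -/
theorem exists_schedule (hκ : Cardinal.aleph0 ≤ κ) (hO : ∀ i : O, Cardinal.mk (Set.Iio i) < κ)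
    (hOκ : Cardinal.mk O = κ) : ∃ g : O → O × O, ∀ α i, ∃ β, α ≤ β ∧ g β = (α, i) := by
  have hmk : Cardinal.mk O = Cardinal.mk ((O × O) × O) := by
    simp [hOκ, Cardinal.mul_eq_self hκ]
  obtain ⟨e⟩ := Cardinal.eq.1 hmk
  refine ⟨fun β => (e β).1, fun α i => ?_⟩
  by_contra! h
  let f (k : O) : Set.Iio α := ⟨e.symm ((α, i), k), by
    by_contra hk
    exact h _ (not_lt.1 hk) (by simp)⟩
  have hf : Function.Injective f := fun k k' hk => by
    simpa using e.symm.injective (congrArg Subtype.val hk)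
  exact ((Cardinal.mk_le_of_injective hf).trans_lt (hO α)).ne hOκ

variable [OrderBot O] [WellFoundedLT O] [NoMaxOrder O]

/-- If a sieve `S` on `X` is not covering, there is a `κ`-cochain over `X` that never enters `S`
and that eventually lifts through every presieve in `B` on one of its members. -/
theorem IsKappaWarp.exists_cochain (hκ : κ.IsRegular) (hC : HasConnectedLimitsLT C κ)
    (hB : IsKappaWarp J κ B) (hcard : ∀ X : C, Cardinal.mk (B X) ≤ κ)
    (hO : ∀ i : O, Cardinal.mk (Set.Iio i) < κ) (hOκ : Cardinal.mk O = κ)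
    {X : C} {S : Sieve X} (hS : S ∉ J X) :
    ∃ (D : Oᵒᵖ ⥤ C) (f : D.obj (.op ⊥) ⟶ X),
      (∀ γ : O, ¬ S (D.map (homOfLE bot_le : ⊥ ⟶ γ).op ≫ f)) ∧
      ∀ α : O, ∀ R ∈ B (D.obj (.op α)), ∃ (β : O) (h : α ≤ β),
        Sieve.generate R (D.map (homOfLE h).op) := by
  by_cases hne : (B X).Nonempty
  swap
  · -- There is nothing to lift through if `B X` is empty.
    refine ⟨(Functor.const _).obj X, 𝟙 X, fun γ h => hS ?_, fun α R hR => absurd ⟨R, hR⟩ hne⟩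
    have : S (𝟙 X) := by simpa using h
    rw [(Sieve.id_mem_iff_eq_top).1 this]
    exact J.top_mem X
  obtain ⟨inst⟩ : Nonempty (Inhabited (Arrow C)) := ⟨⟨Arrow.mk (𝟙 X)⟩⟩
  obtain ⟨F, hX, hlim, hlabel⟩ := exists_labelled_diagram (O := O) hκ hC hO X
  subst hX
  have hne' (x : SeqTree O (Arrow C)) : (B (F.obj x)).Nonempty := by
    obtain ⟨R, hR⟩ := hne
    obtain ⟨R', hR', -⟩ := hB.pullback (F.map (homOfLE (le_top : x ≤ ⊤))) R hR
    exact ⟨R', hR'⟩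
  have hsurj (x : SeqTree O (Arrow C)) :
      ∃ e : O → B (F.obj x), Function.Surjective e := by
    have := (hne' x).to_subtype
    obtain ⟨e⟩ := Cardinal.le_def _ _ |>.1 ((hcard (F.obj x)).trans hOκ.ge)
    exact ⟨Function.invFun e, Function.invFun_surjective e.injective⟩
  choose e he using hsurj
  obtain ⟨g, hg⟩ := exists_schedule hκ.aleph0_le hO hOκ
  -- The node `x` refines the pullback of the presieve which is the task for the time `x.len`.
  have exists_refine (x : SeqTree O (Arrow C)) : ∃ R ∈ B (F.obj x), ∀ y (h : x ≤ y),
      y.len = (g x.len).1 →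
      R ≤ ((Sieve.generate (e y (g x.len).2).1).pullback (F.map (homOfLE h))).arrows := by
    by_cases hy : ∃ y, x ≤ y ∧ y.len = (g x.len).1
    · obtain ⟨y, hxy, hy⟩ := hy
      obtain ⟨R, hR, hle⟩ := hB.pullback (F.map (homOfLE hxy)) _ (e y (g x.len).2).2
      refine ⟨R, hR, fun y' hxy' hy' => ?_⟩
      obtain rfl : y = y' := SeqTree.eq_of_le_of_len_le
        (SeqTree.le_of_le_of_le hxy hxy' (hy'.trans hy.symm).le) (hy.trans hy'.symm).le
      exact hle
    · obtain ⟨R, hR⟩ := hne' x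
      exact ⟨R, hR, fun y h h' => absurd ⟨y, h, h'⟩ hy⟩
  choose R hR hRle using exists_refine
  by_cases hno : ∃ σ : O → Arrow C, ∀ γ, SeqTree.ofFun σ γ ∈ admissible F S R
  swap
  · obtain ⟨M, hM, hMS⟩ := exists_isMulticomposite_le hO hlim hlabel hR hno
    exact absurd (J.superset_covering hMS (hB.multicomposite_covering M hM)) hS
  obtain ⟨σ, hσ⟩ := hno
  have hanti := SeqTree.ofFun_antitone σ
  have hlt {γ δ : O} (h : γ < δ) : SeqTree.ofFun σ δ < SeqTree.ofFun σ γ :=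
    SeqTree.lt_of_le_of_len_lt (hanti h.le) h
  let D : Oᵒᵖ ⥤ C :=
    { obj := fun γ => F.obj (SeqTree.ofFun σ γ.unop)
      map := fun f => F.map (homOfLE (hanti (leOfHom f.unop)))
      map_id := fun γ => F.map_id _
      map_comp := fun f g => F.map_comp (homOfLE _) (homOfLE _) }
  refine ⟨D, F.map (homOfLE le_top), fun γ h => ?_, fun α Rα hRα => ?_⟩
  · obtain ⟨δ, hδ⟩ := exists_gt γ
    refine (hσ δ _ (hlt hδ)).1 ?_
    have := F.map_comp (homOfLE (hanti (bot_le : ⊥ ≤ γ))) (homOfLE le_top)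
    exact (show S (F.map _) from this ▸ h)
  · obtain ⟨i, hi⟩ := he _ ⟨Rα, hRα⟩
    obtain ⟨β, hαβ, hβ⟩ := hg α i
    obtain ⟨δ, hδ⟩ := exists_covBy_of_wellFoundedLT (not_isMax β)
    have hcov : SeqTree.ofFun σ δ ⋖ SeqTree.ofFun σ β :=
      SeqTree.covBy_of_len_covBy_len (hanti hδ.le) hδ
    obtain ⟨-, Z, f, hf, hval⟩ := hσ δ _ hcov.lt
    have hmem : R (SeqTree.ofFun σ β) (F.map (homOfLE hcov.le)) :=
      memArrow_mk_iff.1 ⟨Z, f, hf, hlabel _ _ hcov Z f hval⟩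
    have hle := hRle (SeqTree.ofFun σ β) (SeqTree.ofFun σ α) (hanti hαβ)
      (congrArg Prod.fst hβ).symm
    have hgi : e (SeqTree.ofFun σ α) (g β).2 = ⟨Rα, hRα⟩ := by rw [hβ]; exact hi
    have hgen := hle _ _ hmem
    refine ⟨δ, hαβ.trans hδ.le, ?_⟩
    have := F.map_comp (homOfLE hcov.le) (homOfLE (hanti hαβ))
    change Sieve.generate (e (SeqTree.ofFun σ α) (g β).2).1 _ at hgen
    rw [hgi, ← this] at hgen
    exact hgen

end Branch

/-! ### Points detecting the sieves that are not covering -/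

section Points

open GrothendieckTopology Point Opposite

variable {C : Type u} [SmallCategory C] {J : GrothendieckTopology C} {κ : Cardinal.{u}}

/-- A sieve that is not covering for a `κ`-woven topology is detected by a `κ`-point. -/
theorem exists_isKappaPoint_of_notMem (hκ : κ.IsRegular)
    (hC : HasConnectedLimitsLT C κ) (hJ : IsKappaWoven J κ) {X : C} {S : Sieve X}
    (hS : S ∉ J X) :
    ∃ p : Point.{u} J, IsKappaPoint κ p ∧ ∃ x : p.fiber.obj X,
      ∀ (Y : C) (f : Y ⟶ X), S f → ∀ y : p.fiber.obj Y, p.fiber.map f y ≠ x := by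
  obtain ⟨B, hB, hcard⟩ := hJ
  have : Fact κ.IsRegular := ⟨hκ⟩
  let O := κ.ord.ToType
  have : Nonempty O := Cardinal.mk_ne_zero_iff.1 (by simpa [O] using hκ.pos.ne')
  let : OrderBot O := WellFoundedLT.toOrderBot O
  have : NoMaxOrder O := Cardinal.noMaxOrder hκ.aleph0_le
  obtain ⟨D, f, hDS, hDB⟩ := hB.exists_cochain (O := O) hκ hC hcard
    (fun i => by simpa [O] using Cardinal.mk_Iio_lt i (by simp [O])) (Cardinal.mk_ord_toType κ) hS
  have : IsCardinalFiltered Oᵒᵖᵒᵖ κ := IsCardinalFiltered.of_equivalence κ (opOpEquivalence O).symm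
  have : InitiallySmall.{u} Oᵒᵖ := initiallySmall_of_essentiallySmall _
  let E : C ⥤ Type u := ofIsCofiltered.fiber.{u} D
  have hEB (Y : C) (R : Presieve Y) (hR : R ∈ B Y) (x : E.obj Y) :
      ∃ (Z : C) (g : Z ⟶ Y), R g ∧ ∃ y, E.map g y = x := by
    obtain ⟨α, h, rfl⟩ := ofIsCofiltered.fiberMk_jointly_surjective x
    obtain ⟨R', hR', hle⟩ := hB.pullback h R hR
    obtain ⟨β, hαβ, W, a, b, hb, hab⟩ := hDB α.unop R' hR'
    obtain ⟨Z, a', g, hg, hag⟩ := hle _ _ hb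
    refine ⟨Z, g, hg, ofIsCofiltered.fiberMk (a ≫ a'), ?_⟩
    rw [ofIsCofiltered.fiber_map_fiberMk, Category.assoc, hag, ← Category.assoc, hab,
      ofIsCofiltered.fiberMk_map_comp]
  let p : Point.{u} J :=
    { fiber := E
      jointly_surjective := fun {Y} R hR x => by
        obtain ⟨M, ⟨T⟩, hM⟩ := hB.contains_multicomposite Y R hR
        obtain ⟨Z, g, hg, y, hy⟩ := T.exists_lift_multicomposite hκ hC E
          (fun K _ hK => preservesLimitsOfShape_fiber D K hK) hEB x
        exact ⟨Z, g, hM _ hg, y, hy⟩ }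
  have : IsCardinalFiltered p.fiber.Elementsᵒᵖ κ := isCardinalFiltered_elements_fiber D
  refine ⟨p, isKappaPoint_of_isCardinalFiltered p, ofIsCofiltered.fiberMk f, fun Y g hg y hy => ?_⟩
  obtain ⟨γ, h, rfl⟩ := ofIsCofiltered.fiberMk_jointly_surjective y
  have hy : ofIsCofiltered.fiberMk.{u} (h ≫ g) = ofIsCofiltered.fiberMk f := by
    rw [← hy]
    exact (ofIsCofiltered.fiber_map_fiberMk D h g).symm
  rw [← ofIsCofiltered.fiberMk_map_comp D (homOfLE (bot_le : ⊥ ≤ γ.unop)).op f] at hy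
  obtain ⟨δ, q, hq⟩ := ofIsCofiltered.exists_of_fiberMk_eq_fiberMk hy
  refine hDS δ.unop ?_
  have hfac : D.map (homOfLE (bot_le : ⊥ ≤ δ.unop)).op ≫ f = D.map q ≫ h ≫ g := by
    rw [hq, ← Category.assoc, ← D.map_comp]
    rfl
  rw [hfac, ← Category.assoc]
  exact S.downward_closed hg _

end Points

theorem theorem3p17 {C : Type u} [SmallCategory C] (J : GrothendieckTopology C)
    (κ : Cardinal.{u}) (hκ : κ.IsRegular) (hC : HasConnectedLimitsLT C κ)
    (hJ : IsKappaWoven J κ) :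
    HasEnoughKappaPoints J κ := by
  choose p hp x hx using fun s : { s : Σ X : C, Sieve X // s.2 ∉ J s.1 } =>
    exists_isKappaPoint_of_notMem hκ hC hJ s.2
  refine ⟨.ofObj p, inferInstance, .mk' fun X S hS => ?_, ?_⟩
  · by_contra h
    obtain ⟨Y, f, hf, y, hy⟩ := hS ⟨p ⟨⟨X, S⟩, h⟩, .mk _⟩ (x ⟨⟨X, S⟩, h⟩)
    exact hx ⟨⟨X, S⟩, h⟩ Y f hf y hy
  · rintro _ ⟨s⟩
    exact hp s
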